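/- Let $M$ be a compact (Hausdorff) complex manifold of dimension $m$, with canonical bundle $K_M=\bigwedge^m T^*M$, and let $V$ be a complex vector space of dimension $m$. A branched holomorphic co-parallelism on $TM$ is a holomorphic one-form $\omega\in\Omega^1(M,V)$ such that $\omega_u:T_uM\to V$ is a linear isomorphism for all $u$ in some open dense subset of $M$; its branching locus is the set of points $u$ at which $\omega_u$ is not an isomorphism. An effective divisor $D$ on $M$ (given by local holomorphic equations, not identically zero on any nonempty open set, up to units) is said to represent the canonical class if $\mathcal O(D)\cong K_M$ as holomorphic line bundles. (1) Let $\omega$ be a branched holomorphic co-parallelism and let $\omega_1,\dots,\omega_m$ be its components in any basis of $V$. Then the zero divisor $D$ of the section $\omega_1\wedge\dots\wedge\omega_m$ of $K_M$ is a well-defined effective divisor which represents the canonical class, and its support is the branching locus of $\omega$. In particular the branching locus is either empty or (the support of) a nonzero effective divisor representing the canonical class. (2) If $K_M$ is holomorphically trivial, then no nonzero effective divisor represents the canonical class. If no nonzero effective divisor on $M$ represents the canonical class, then every branched holomorphic co-parallelism $\omega$ on $TM$ has empty branching locus, so that $\omega_u$ is an isomorphism for every $u\in M$ and $M$ is (holomorphically)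 parallelizable, i.e. $TM$ has a holomorphic trivialization. -/

import Mathlib

open scoped Manifold ContDiff Bundle

noncomputable section

/-- `HolOn m f W`: the function `f` is holomorphic on the subset `W` of the complex manifold `M`
of dimension `m`. -/
def HolOn (m : ℕ) {M : Type*} [TopologicalSpace M] [ChartedSpace (EuclideanSpace ℂ (Fin m)) M]
    (f : M → ℂ) (W : Set M) : Prop :=
  ContMDiffOn 𝓘(ℂ, EuclideanSpace ℂ (Fin m)) 𝓘(ℂ) ω f W

/-- `HolUnitOn m f W`: the function `f` is holomorphic and nowhere zero on `W`,
i.e. an element of `𝒪*(W)` when `W` is open. -/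
def HolUnitOn (m : ℕ) {M : Type*} [TopologicalSpace M] [ChartedSpace (EuclideanSpace ℂ (Fin m)) M]
    (f : M → ℂ) (W : Set M) : Prop :=
  HolOn m f W ∧ ∀ p ∈ W, f p ≠ 0

section Units

variable {m : ℕ} {M : Type*} [TopologicalSpace M] [ChartedSpace (EuclideanSpace ℂ (Fin m)) M]
  {f g : M → ℂ} {W W' : Set M}

theorem HolOn.mono (hf : HolOn m f W) (h : W' ⊆ W) : HolOn m f W' :=
  ContMDiffOn.mono hf h

theorem HolOn.mul (hf : HolOn m f W) (hg : HolOn m g W) : HolOn m (fun p => f p * g p) W :=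
  ContMDiffOn.mul hf hg

theorem HolOn.congr (hf : HolOn m f W) (h : ∀ p ∈ W, g p = f p) : HolOn m g W :=
  ContMDiffOn.congr hf h

theorem HolOn.continuousOn (hf : HolOn m f W) : ContinuousOn f W :=
  ContMDiffOn.continuousOn hf

theorem HolOn.of_locally (h : ∀ p ∈ W, ∃ O, IsOpen O ∧ p ∈ O ∧ HolOn m f (W ∩ O)) :
    HolOn m f W :=
  contMDiffOn_of_locally_contMDiffOn h

theorem HolUnitOn.one : HolUnitOn m (fun _ : M => (1 : ℂ)) W :=
  ⟨contMDiffOn_const, fun _ _ => one_ne_zero⟩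

theorem HolUnitOn.mono (hf : HolUnitOn m f W) (h : W' ⊆ W) : HolUnitOn m f W' :=
  ⟨hf.1.mono h, fun p hp => hf.2 p (h hp)⟩

theorem HolUnitOn.mul (hf : HolUnitOn m f W) (hg : HolUnitOn m g W) :
    HolUnitOn m (fun p => f p * g p) W :=
  ⟨hf.1.mul hg.1, fun p hp => mul_ne_zero (hf.2 p hp) (hg.2 p hp)⟩

theorem HolUnitOn.inv (hf : HolUnitOn m f W) : HolUnitOn m (fun p => (f p)⁻¹) W :=
  ⟨fun p hp => ((contDiffAt_inv ℂ (hf.2 p hp)).contMDiffAt).comp_contMDiffWithinAt p (hf.1 p hp),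
    fun p hp => inv_ne_zero (hf.2 p hp)⟩

theorem HolUnitOn.congr (hf : HolUnitOn m f W) (h : ∀ p ∈ W, g p = f p) : HolUnitOn m g W :=
  ⟨hf.1.congr h, fun p hp => h p hp ▸ hf.2 p hp⟩

end Units

/-! ### Holomorphic line bundles up to isomorphism -/

/-- A holomorphic line bundle on `M` given by transition functions: an open cover `U`
and a Čech 1-cocycle `g` of `𝒪*`.  A section is a family of functions `s x` on `U x`
with `s x = g x y * s y` on `U x ∩ U y`.  (Indexing the cover by the points of `M`, with `x ∈ U x`,
is no restriction: every open cover has such a refinement.) -/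
structure LineCocycle (m : ℕ) (M : Type*) [TopologicalSpace M]
    [ChartedSpace (EuclideanSpace ℂ (Fin m)) M] where
  U : M → Set M
  isOpen_U : ∀ x, IsOpen (U x)
  mem_U : ∀ x, x ∈ U x
  g : M → M → M → ℂ
  unit_g : ∀ x y, HolUnitOn m (g x y) (U x ∩ U y)
  cocycle : ∀ x y z, ∀ p ∈ U x ∩ U y ∩ U z, g x y p * g y z p = g x z p

/-- An isomorphism between the line bundles given by two cocycles: it is multiplication by
`h x x'` from the trivialization of the second bundle over `U' x'` to the trivialization of the
first bundle over `U x`. -/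
def LineCocycle.Iso {m : ℕ} {M : Type*} [TopologicalSpace M]
    [ChartedSpace (EuclideanSpace ℂ (Fin m)) M] (L L' : LineCocycle m M) : Prop :=
  ∃ h : M → M → M → ℂ, (∀ x x', HolUnitOn m (h x x') (L.U x ∩ L'.U x')) ∧
    ∀ x y x' y', ∀ p ∈ (L.U x ∩ L.U y) ∩ (L'.U x' ∩ L'.U y'),
      L.g x y p * h y y' p = h x x' p * L'.g x' y' p

section LineBundles

variable {m : ℕ} {M : Type*} [TopologicalSpace M] [ChartedSpace (EuclideanSpace ℂ (Fin m)) M]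

theorem LineCocycle.g_self (L : LineCocycle m M) {x p : M} (hp : p ∈ L.U x) : L.g x x p = 1 := by
  have h := L.cocycle x x x p ⟨⟨hp, hp⟩, hp⟩
  exact mul_left_cancel₀ ((L.unit_g x x).2 p ⟨hp, hp⟩) (by rw [h, mul_one])

theorem LineCocycle.Iso.refl (L : LineCocycle m M) : L.Iso L :=
  ⟨L.g, L.unit_g, fun x y x' y' p hp => by
    rw [L.cocycle x y y' p ⟨hp.1, hp.2.2⟩, L.cocycle x x' y' p ⟨⟨hp.1.1, hp.2.1⟩, hp.2.2⟩]⟩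

theorem LineCocycle.Iso.symm {L L' : LineCocycle m M} : L.Iso L' → L'.Iso L := by
  rintro ⟨h, hu, hc⟩
  refine ⟨fun x' x p => (h x x' p)⁻¹,
    fun x' x => (hu x x').inv.mono fun p hp => ⟨hp.2, hp.1⟩, fun x' y' x y p hp => ?_⟩
  have e := hc x y x' y' p ⟨hp.2, hp.1⟩
  have h1 := (hu x x').2 p ⟨hp.2.1, hp.1.1⟩
  have h2 := (hu y y').2 p ⟨hp.2.2, hp.1.2⟩
  field_simp
  linear_combination -e

theorem LineCocycle.Iso.trans {L L' L'' : LineCocycle m M} :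
    L.Iso L' → L'.Iso L'' → L.Iso L'' := by
  rintro ⟨h, hu, hc⟩ ⟨k, ku, kc⟩
  -- the product does not depend on the intermediate trivialization
  have indep : ∀ x x'' a b : M, ∀ p ∈ (L.U x ∩ L''.U x'') ∩ (L'.U a ∩ L'.U b),
      h x a p * k a x'' p = h x b p * k b x'' p := by
    intro x x'' a b p hp
    have e1 := hc x x a b p ⟨⟨hp.1.1, hp.1.1⟩, hp.2⟩
    have e2 := kc a b x'' x'' p ⟨hp.2, ⟨hp.1.2, hp.1.2⟩⟩
    rw [L.g_self hp.1.1] at e1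
    rw [L''.g_self hp.1.2] at e2
    linear_combination (-k b x'' p) * e1 - h x a p * e2
  refine ⟨fun x x'' p => h x p p * k p x'' p, fun x x'' => ⟨HolOn.of_locally fun q hq =>
    ⟨L'.U q, L'.isOpen_U q, L'.mem_U q, ?_⟩, fun p hp => mul_ne_zero
      ((hu x p).2 p ⟨hp.1, L'.mem_U p⟩) ((ku p x'').2 p ⟨L'.mem_U p, hp.2⟩)⟩, ?_⟩
  · refine (((hu x q).1.mono fun p hp => ⟨hp.1.1, hp.2⟩).mul
      ((ku q x'').1.mono fun p hp => ⟨hp.2, hp.1.2⟩)).congr fun p hp => ?_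
    exact indep x x'' p q p ⟨hp.1, L'.mem_U p, hp.2⟩
  · intro x y x'' y'' p hp
    have e1 := hc x y p p p ⟨hp.1, L'.mem_U p, L'.mem_U p⟩
    have e2 := kc p p x'' y'' p ⟨⟨L'.mem_U p, L'.mem_U p⟩, hp.2⟩
    rw [L'.g_self (L'.mem_U p)] at e1 e2
    linear_combination k p y'' p * e1 + h x p p * e2

end LineBundles

/-- Isomorphism of holomorphic line bundles is an equivalence relation. -/
instance LineCocycle.setoid (m : ℕ) (M : Type*) [TopologicalSpace M]
    [ChartedSpace (EuclideanSpace ℂ (Fin m)) M] : Setoid (LineCocycle m M) where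
  r := LineCocycle.Iso
  iseqv := ⟨LineCocycle.Iso.refl, LineCocycle.Iso.symm, LineCocycle.Iso.trans⟩

/-- The set `Pic M = H¹(M, 𝒪*)` of isomorphism classes of holomorphic line bundles on `M`. -/
def Pic (m : ℕ) (M : Type*) [TopologicalSpace M] [ChartedSpace (EuclideanSpace ℂ (Fin m)) M] :
    Type _ :=
  Quotient (LineCocycle.setoid m M)

/-- The class of the trivial line bundle. -/
def trivialClass (m : ℕ) (M : Type*) [TopologicalSpace M]
    [ChartedSpace (EuclideanSpace ℂ (Fin m)) M] : Pic m M :=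
  Quotient.mk _
    { U := fun _ => Set.univ
      isOpen_U := fun _ => isOpen_univ
      mem_U := fun _ => Set.mem_univ _
      g := fun _ _ _ => 1
      unit_g := fun _ _ => HolUnitOn.one
      cocycle := fun _ _ _ _ _ => one_mul 1 }

section Canonical

variable {m : ℕ} {M : Type*} [TopologicalSpace M] [ChartedSpace (EuclideanSpace ℂ (Fin m)) M]
  [IsManifold 𝓘(ℂ, EuclideanSpace ℂ (Fin m)) ω M]

/-- The Jacobian determinant `det (∂ zʸ / ∂ zˣ)` at `p` of the change of coordinates from the
chart at `x` to the chart at `y`. -/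
def jacobian (m : ℕ) (M : Type*) [TopologicalSpace M] [ChartedSpace (EuclideanSpace ℂ (Fin m)) M]
    [IsManifold 𝓘(ℂ, EuclideanSpace ℂ (Fin m)) ω M] (x y p : M) : ℂ :=
  (tangentCoordChange 𝓘(ℂ, EuclideanSpace ℂ (Fin m)) x y p).det

theorem jacobian_self {x p : M}
    (hp : p ∈ (chartAt (EuclideanSpace ℂ (Fin m)) x).source) : jacobian m M x x p = 1 := by
  have : tangentCoordChange 𝓘(ℂ, EuclideanSpace ℂ (Fin m)) x x p = ContinuousLinearMap.id ℂ _ := by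
    ext1 v
    exact tangentCoordChange_self (by simpa using hp)
  rw [jacobian, this]
  exact LinearMap.det_id

theorem jacobian_comp {x y z p : M}
    (hx : p ∈ (chartAt (EuclideanSpace ℂ (Fin m)) x).source)
    (hy : p ∈ (chartAt (EuclideanSpace ℂ (Fin m)) y).source)
    (hz : p ∈ (chartAt (EuclideanSpace ℂ (Fin m)) z).source) :
    jacobian m M x y p * jacobian m M y z p = jacobian m M x z p := by
  have : tangentCoordChange 𝓘(ℂ, EuclideanSpace ℂ (Fin m)) x z p =
      (tangentCoordChange 𝓘(ℂ, EuclideanSpace ℂ (Fin m)) y z p).comp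
        (tangentCoordChange 𝓘(ℂ, EuclideanSpace ℂ (Fin m)) x y p) := by
    ext1 v
    exact (tangentCoordChange_comp (by simpa using ⟨⟨hx, hy⟩, hz⟩)).symm
  rw [jacobian, jacobian, jacobian, this, mul_comm]
  exact (LinearMap.det_comp _ _).symm

theorem jacobian_hol (x y : M) :
    HolOn m (jacobian m M x y) ((chartAt (EuclideanSpace ℂ (Fin m)) x).source ∩
      (chartAt (EuclideanSpace ℂ (Fin m)) y).source) := by
  have hb : ContMDiffOn 𝓘(ℂ, EuclideanSpace ℂ (Fin m))
      𝓘(ℂ, EuclideanSpace ℂ (Fin m) →L[ℂ] EuclideanSpace ℂ (Fin m)) ω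
      (tangentCoordChange 𝓘(ℂ, EuclideanSpace ℂ (Fin m)) x y)
      ((chartAt (EuclideanSpace ℂ (Fin m)) x).source ∩
        (chartAt (EuclideanSpace ℂ (Fin m)) y).source) := by
    have : (tangentBundleCore 𝓘(ℂ, EuclideanSpace ℂ (Fin m)) M).IsContMDiff
        𝓘(ℂ, EuclideanSpace ℂ (Fin m)) ω := by
      have : IsManifold 𝓘(ℂ, EuclideanSpace ℂ (Fin m)) (ω + 1) M := by simpa
      exact tangentBundleCore.isContMDiff
    exact this.contMDiffOn_coordChange _ _
  have hdet : ContDiff ℂ ω (fun A : EuclideanSpace ℂ (Fin m) →L[ℂ] EuclideanSpace ℂ (Fin m) =>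
      A.det) := by
    have : (fun A : EuclideanSpace ℂ (Fin m) →L[ℂ] EuclideanSpace ℂ (Fin m) => A.det) =
        fun A => ∑ σ : Equiv.Perm (Fin m), ((Equiv.Perm.sign σ : ℤ) : ℂ) *
          ∏ i, (A (EuclideanSpace.single i 1)) (σ i) := by
      funext A
      rw [ContinuousLinearMap.det,
        ← LinearMap.det_toMatrix (EuclideanSpace.basisFun (Fin m) ℂ).toBasis, Matrix.det_apply']
      simp [LinearMap.toMatrix_apply]
    rw [this]
    fun_prop
  exact hdet.contMDiff.comp_contMDiffOn hb

end Canonical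

/-- The canonical bundle `K_M = ⋀ᵐ T*M`, trivialized over the domain of the chart at `x` (with
coordinates `z`) by `dz₁ ∧ … ∧ dz_m`.  From `dzʸ₁ ∧ … ∧ dzʸ_m = det (∂ zʸ / ∂ zˣ) dzˣ₁ ∧ … ∧ dzˣ_m`
its transition functions `g x y` are the Jacobian determinants `det (∂ zʸ / ∂ zˣ)`. -/
def canonicalCocycle (m : ℕ) (M : Type*) [TopologicalSpace M]
    [ChartedSpace (EuclideanSpace ℂ (Fin m)) M]
    [IsManifold 𝓘(ℂ, EuclideanSpace ℂ (Fin m)) ω M] : LineCocycle m M where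
  U x := (chartAt (EuclideanSpace ℂ (Fin m)) x).source
  isOpen_U x := (chartAt (EuclideanSpace ℂ (Fin m)) x).open_source
  mem_U x := mem_chart_source _ x
  g := jacobian m M
  unit_g x y := ⟨jacobian_hol x y, fun p hp h0 => by
    have h := jacobian_comp hp.1 hp.2 hp.1
    rw [h0, zero_mul, jacobian_self hp.1] at h
    exact zero_ne_one h⟩
  cocycle _ _ _ _ hp := jacobian_comp hp.1.1 hp.1.2 hp.2

/-- The canonical class of `M`. -/
def canonicalClass (m : ℕ) (M : Type*) [TopologicalSpace M]
    [ChartedSpace (EuclideanSpace ℂ (Fin m)) M]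
    [IsManifold 𝓘(ℂ, EuclideanSpace ℂ (Fin m)) ω M] : Pic m M :=
  Quotient.mk _ (canonicalCocycle m M)

/-! ### Effective divisors -/

/-- A system of local equations for an effective (Cartier) divisor on `M`: an open cover `U`,
holomorphic functions `f x` on `U x` that do not vanish identically on any nonempty open subset,
and that differ by holomorphic units on the overlaps. -/
structure LocalEquations (m : ℕ) (M : Type*) [TopologicalSpace M]
    [ChartedSpace (EuclideanSpace ℂ (Fin m)) M] where
  U : M → Set M
  isOpen_U : ∀ x, IsOpen (U x)
  mem_U : ∀ x, x ∈ U x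
  f : M → M → ℂ
  hol_f : ∀ x, HolOn m (f x) (U x)
  dense_f : ∀ x, U x ⊆ closure {p | f x p ≠ 0}
  compat : ∀ x y, ∃ g : M → ℂ, HolUnitOn m g (U x ∩ U y) ∧ ∀ p ∈ U x ∩ U y, f x p = g p * f y p

/-- Two systems of local equations define the same divisor if their members differ by
holomorphic units. -/
def LocalEquations.Equiv {m : ℕ} {M : Type*} [TopologicalSpace M]
    [ChartedSpace (EuclideanSpace ℂ (Fin m)) M] (S S' : LocalEquations m M) : Prop :=
  ∀ x x', ∃ h : M → ℂ, HolUnitOn m h (S.U x ∩ S'.U x') ∧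
    ∀ p ∈ S.U x ∩ S'.U x', S.f x p = h p * S'.f x' p

section Divisors

variable {m : ℕ} {M : Type*} [TopologicalSpace M] [ChartedSpace (EuclideanSpace ℂ (Fin m)) M]

/-- Cancellation of a local equation: two continuous functions with the same product with
`S.f x` on an open part of `S.U x` are equal there. -/
theorem LocalEquations.cancel (S : LocalEquations m M) (x : M) {W : Set M} (hW : IsOpen W)
    (hWU : W ⊆ S.U x) {a b : M → ℂ} (ha : ContinuousOn a W) (hb : ContinuousOn b W)
    (h : ∀ p ∈ W, a p * S.f x p = b p * S.f x p) : ∀ p ∈ W, a p = b p := by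
  intro p hp
  by_contra hne
  have hsub : ContinuousOn (fun q => a q - b q) W := ha.sub hb
  have hO : IsOpen (W ∩ (fun q => a q - b q) ⁻¹' {0}ᶜ) :=
    hsub.isOpen_inter_preimage hW isOpen_compl_singleton
  have hpO : p ∈ W ∩ (fun q => a q - b q) ⁻¹' {0}ᶜ := ⟨hp, by simpa [sub_eq_zero] using hne⟩
  obtain ⟨q, hq, hq0⟩ := mem_closure_iff.1 (S.dense_f x (hWU hp)) _ hO hpO
  exact hq.2 (by simpa [sub_eq_zero] using mul_right_cancel₀ hq0 (h q hq.1))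

theorem LocalEquations.Equiv.refl (S : LocalEquations m M) : S.Equiv S := S.compat

theorem LocalEquations.Equiv.symm {S S' : LocalEquations m M} : S.Equiv S' → S'.Equiv S := by
  intro h x' x
  obtain ⟨u, hu, e⟩ := h x x'
  refine ⟨fun p => (u p)⁻¹, hu.inv.mono fun p hp => ⟨hp.2, hp.1⟩, fun p hp => ?_⟩
  rw [e p ⟨hp.2, hp.1⟩, inv_mul_cancel_left₀ (hu.2 p ⟨hp.2, hp.1⟩)]

theorem LocalEquations.Equiv.trans {S S' S'' : LocalEquations m M} :
    S.Equiv S' → S'.Equiv S'' → S.Equiv S'' := by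
  intro h k x x''
  choose u hu eu using h
  choose v hv ev using k
  have indep : ∀ a, ∀ p ∈ (S.U x ∩ S''.U x'') ∩ S'.U a,
      u x p p * v p x'' p = u x a p * v a x'' p := by
    intro a q hq
    refine S''.cancel x'' (W := (S.U x ∩ S''.U x'') ∩ (S'.U a ∩ S'.U q))
      (((S.isOpen_U _).inter (S''.isOpen_U _)).inter ((S'.isOpen_U _).inter (S'.isOpen_U _)))
      (fun p hp => hp.1.2) (a := fun p => u x q p * v q x'' p)
      (b := fun p => u x a p * v a x'' p) ?_ ?_ ?_ q ⟨hq.1, hq.2, S'.mem_U q⟩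
    · exact (((hu x q).1.mono fun p hp => ⟨hp.1.1, hp.2.2⟩).mul
        ((hv q x'').1.mono fun p hp => ⟨hp.2.2, hp.1.2⟩)).continuousOn
    · exact (((hu x a).1.mono fun p hp => ⟨hp.1.1, hp.2.1⟩).mul
        ((hv a x'').1.mono fun p hp => ⟨hp.2.1, hp.1.2⟩)).continuousOn
    · intro p hp
      have e1 := eu x q p ⟨hp.1.1, hp.2.2⟩
      have e2 := ev q x'' p ⟨hp.2.2, hp.1.2⟩
      have e3 := eu x a p ⟨hp.1.1, hp.2.1⟩
      have e4 := ev a x'' p ⟨hp.2.1, hp.1.2⟩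
      rw [mul_assoc, mul_assoc, ← e2, ← e4, ← e1, ← e3]
  refine ⟨fun p => u x p p * v p x'' p, ⟨HolOn.of_locally fun q hq =>
    ⟨S'.U q, S'.isOpen_U q, S'.mem_U q, ?_⟩, fun p hp => mul_ne_zero
      ((hu x p).2 p ⟨hp.1, S'.mem_U p⟩) ((hv p x'').2 p ⟨S'.mem_U p, hp.2⟩)⟩, ?_⟩
  · exact (((hu x q).1.mono fun p hp => ⟨hp.1.1, hp.2⟩).mul
      ((hv q x'').1.mono fun p hp => ⟨hp.2, hp.1.2⟩)).congr fun p hp => indep q p hp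
  · intro p hp
    rw [mul_assoc, ← ev p x'' p ⟨S'.mem_U p, hp.2⟩, ← eu x p p ⟨hp.1, S'.mem_U p⟩]

end Divisors

instance LocalEquations.setoid (m : ℕ) (M : Type*) [TopologicalSpace M]
    [ChartedSpace (EuclideanSpace ℂ (Fin m)) M] : Setoid (LocalEquations m M) where
  r := LocalEquations.Equiv
  iseqv := ⟨LocalEquations.Equiv.refl, LocalEquations.Equiv.symm, LocalEquations.Equiv.trans⟩

/-- Effective divisors on `M`: systems of local equations up to multiplication by units. -/
def EffectiveDivisor (m : ℕ) (M : Type*) [TopologicalSpace M]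
    [ChartedSpace (EuclideanSpace ℂ (Fin m)) M] : Type _ :=
  Quotient (LocalEquations.setoid m M)

/-- The zero divisor, with local equations `1`. -/
instance EffectiveDivisor.instZero (m : ℕ) (M : Type*) [TopologicalSpace M]
    [ChartedSpace (EuclideanSpace ℂ (Fin m)) M] : Zero (EffectiveDivisor m M) where
  zero := Quotient.mk _
    { U := fun _ => Set.univ
      isOpen_U := fun _ => isOpen_univ
      mem_U := fun _ => Set.mem_univ _
      f := fun _ _ => 1
      hol_f := fun _ => HolUnitOn.one.1
      dense_f := fun _ _ _ => subset_closure one_ne_zero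
      compat := fun _ _ => ⟨fun _ => 1, HolUnitOn.one, fun _ _ => (one_mul 1).symm⟩ }

section LineBundleOfDivisor

variable {m : ℕ} {M : Type*} [TopologicalSpace M] [ChartedSpace (EuclideanSpace ℂ (Fin m)) M]

/-- The zero set of a system of local equations. -/
def LocalEquations.zeroSet (S : LocalEquations m M) : Set M := {p | S.f p p = 0}

theorem LocalEquations.zeroSet_eq {S S' : LocalEquations m M} (h : S.Equiv S') :
    S.zeroSet = S'.zeroSet := by
  ext p
  obtain ⟨u, hu, e⟩ := h p p
  have hp : p ∈ S.U p ∩ S'.U p := ⟨S.mem_U p, S'.mem_U p⟩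
  simp only [zeroSet, Set.mem_ofPred_eq, e p hp, mul_eq_zero, hu.2 p hp, false_or]

/-- The line bundle `𝒪(D)` of the divisor `D` with local equations `f x`: its transition functions
are the units `g x y = f x / f y`. -/
def LocalEquations.toCocycle (S : LocalEquations m M) : LineCocycle m M where
  U := S.U
  isOpen_U := S.isOpen_U
  mem_U := S.mem_U
  g x y := Classical.choose (S.compat x y)
  unit_g x y := (Classical.choose_spec (S.compat x y)).1
  cocycle x y z := by
    have e := fun x y => (Classical.choose_spec (S.compat x y)).2
    have c := fun x y => (Classical.choose_spec (S.compat x y)).1.1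
    refine S.cancel z (((S.isOpen_U _).inter (S.isOpen_U _)).inter (S.isOpen_U _))
      (fun p hp => hp.2) (a := fun p => Classical.choose (S.compat x y) p *
        Classical.choose (S.compat y z) p) ?_ ?_ ?_
    · exact (((c x y).mono fun p hp => hp.1).mul
        ((c y z).mono fun p hp => ⟨hp.1.2, hp.2⟩)).continuousOn
    · exact ((c x z).mono fun p hp => ⟨hp.1.1, hp.2⟩).continuousOn
    · intro p hp
      rw [mul_assoc, ← e y z p ⟨hp.1.2, hp.2⟩, ← e x y p hp.1, ← e x z p ⟨hp.1.1, hp.2⟩]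

theorem LocalEquations.toCocycle_iso {S S' : LocalEquations m M} (h : S.Equiv S') :
    S.toCocycle.Iso S'.toCocycle := by
  choose u hu eu using h
  refine ⟨u, hu, fun x y x' y' => ?_⟩
  have e := fun x y => (Classical.choose_spec (S.compat x y)).2
  have e' := fun x y => (Classical.choose_spec (S'.compat x y)).2
  refine S'.cancel y' (((S.isOpen_U _).inter (S.isOpen_U _)).inter
    ((S'.isOpen_U _).inter (S'.isOpen_U _))) (fun p hp => hp.2.2)
      (a := fun p => S.toCocycle.g x y p * u y y' p)
      (b := fun p => u x x' p * S'.toCocycle.g x' y' p) ?_ ?_ ?_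
  · exact (((S.toCocycle.unit_g x y).1.mono fun p hp => hp.1).mul
      ((hu y y').1.mono fun p hp => ⟨hp.1.2, hp.2.2⟩)).continuousOn
  · exact (((hu x x').1.mono fun p hp => ⟨hp.1.1, hp.2.1⟩).mul
      ((S'.toCocycle.unit_g x' y').1.mono fun p hp => hp.2)).continuousOn
  · intro p hp
    rw [mul_assoc, mul_assoc, ← eu y y' p ⟨hp.1.2, hp.2.2⟩]
    exact (e x y p hp.1).symm.trans ((eu x x' p ⟨hp.1.1, hp.2.1⟩).trans
      (congrArg _ (e' x' y' p hp.2)))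

/-- The support of an effective divisor. -/
def EffectiveDivisor.support (D : EffectiveDivisor m M) : Set M :=
  Quotient.lift LocalEquations.zeroSet (fun _ _ h => LocalEquations.zeroSet_eq h) D

/-- The class in `Pic M` of the line bundle `𝒪(D)`. -/
def EffectiveDivisor.lineBundleClass (D : EffectiveDivisor m M) : Pic m M :=
  Quotient.lift (fun S : LocalEquations m M => (Quotient.mk _ S.toCocycle : Pic m M))
    (fun _ _ h => Quotient.sound (LocalEquations.toCocycle_iso h)) D

end LineBundleOfDivisor

/-- The canonical class has an effective representative, i.e. `K_M ≅ 𝒪(D)` for some nonzero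
effective divisor `D`. -/
def CanonicalClassHasEffectiveRep (m : ℕ) (M : Type*) [TopologicalSpace M]
    [ChartedSpace (EuclideanSpace ℂ (Fin m)) M]
    [IsManifold 𝓘(ℂ, EuclideanSpace ℂ (Fin m)) ω M] : Prop :=
  ∃ D : EffectiveDivisor m M, D ≠ 0 ∧ D.lineBundleClass = canonicalClass m M

/-! ### Top-degree forms and their zero divisors -/

/-- A (not necessarily holomorphic) section of `⋀ᵐ T*M`. -/
abbrev TopForm (m : ℕ) (M : Type*) [TopologicalSpace M]
    [ChartedSpace (EuclideanSpace ℂ (Fin m)) M] : Type _ :=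
  ∀ p : M, (TangentSpace 𝓘(ℂ, EuclideanSpace ℂ (Fin m)) p) [⋀^Fin m]→ₗ[ℂ] ℂ

/-- The coordinate vector field `∂ / ∂ zᵢ` of the chart at `x` (meaningful on its domain). -/
def coordVector (m : ℕ) (M : Type*) [TopologicalSpace M]
    [ChartedSpace (EuclideanSpace ℂ (Fin m)) M]
    [IsManifold 𝓘(ℂ, EuclideanSpace ℂ (Fin m)) ω M] (x : M) (i : Fin m) (p : M) :
    TangentSpace 𝓘(ℂ, EuclideanSpace ℂ (Fin m)) p :=
  (trivializationAt (EuclideanSpace ℂ (Fin m))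
    (TangentSpace 𝓘(ℂ, EuclideanSpace ℂ (Fin m)) : M → Type _) x).symm p
      (EuclideanSpace.single i (1 : ℂ))

/-- The coefficient `η (∂ / ∂ z₁, …, ∂ / ∂ z_m)` of the form `η = a dz₁ ∧ … ∧ dz_m` in the chart
at `x`. -/
def TopForm.coeff {m : ℕ} {M : Type*} [TopologicalSpace M]
    [ChartedSpace (EuclideanSpace ℂ (Fin m)) M]
    [IsManifold 𝓘(ℂ, EuclideanSpace ℂ (Fin m)) ω M] (η : TopForm m M) (x p : M) : ℂ :=
  η p fun i => coordVector m M x i p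

/-- `D` is the zero divisor `div η` of the holomorphic section `η` of `K_M`: the coefficients of
`η` in the charts form a system of local equations, and `D` is the divisor which they define. -/
def EffectiveDivisor.IsZeroDivisorOf {m : ℕ} {M : Type*} [TopologicalSpace M]
    [ChartedSpace (EuclideanSpace ℂ (Fin m)) M]
    [IsManifold 𝓘(ℂ, EuclideanSpace ℂ (Fin m)) ω M] (D : EffectiveDivisor m M)
    (η : TopForm m M) : Prop :=
  ∃ S : LocalEquations m M, (∀ x, S.U x = (chartAt (EuclideanSpace ℂ (Fin m)) x).source) ∧
    (∀ x, ∀ p ∈ S.U x, S.f x p = η.coeff x p) ∧ D = Quotient.mk _ S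

/-! ### Branched holomorphic co-parallelisms -/

/-- Holomorphic one-forms on `M` with values in `V`. -/
abbrev HolOneForm (m : ℕ) (M : Type*) [TopologicalSpace M]
    [ChartedSpace (EuclideanSpace ℂ (Fin m)) M]
    [IsManifold 𝓘(ℂ, EuclideanSpace ℂ (Fin m)) ω M] (V : Type*) [NormedAddCommGroup V]
    [NormedSpace ℂ V] : Type _ :=
  ContMDiffSection 𝓘(ℂ, EuclideanSpace ℂ (Fin m)) (EuclideanSpace ℂ (Fin m) →L[ℂ] V) ω
    (fun p : M => TangentSpace 𝓘(ℂ, EuclideanSpace ℂ (Fin m)) p →L[ℂ] Bundle.Trivial M V p)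

section CoParallelism

variable {m : ℕ} {M : Type*} [TopologicalSpace M] [ChartedSpace (EuclideanSpace ℂ (Fin m)) M]
  [IsManifold 𝓘(ℂ, EuclideanSpace ℂ (Fin m)) ω M] {V : Type*} [NormedAddCommGroup V]
  [NormedSpace ℂ V]

/-- The value of a `V`-valued one-form at `p`, as a linear map `T_p M → V`. -/
def HolOneForm.at (θ : HolOneForm m M V) (p : M) :
    TangentSpace 𝓘(ℂ, EuclideanSpace ℂ (Fin m)) p →ₗ[ℂ] V :=
  (show TangentSpace 𝓘(ℂ, EuclideanSpace ℂ (Fin m)) p →L[ℂ] V from θ p).toLinearMap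

/-- The set of points where the one-form fails to be a linear isomorphism. -/
def HolOneForm.branchingLocus (θ : HolOneForm m M V) : Set M :=
  {p | ¬ Function.Bijective (θ.at p)}

/-- `θ` is a holomorphic trivialization (parallelization) of `TM`. -/
def HolOneForm.IsParallelism (θ : HolOneForm m M V) : Prop :=
  Module.finrank ℂ V = m ∧ ∀ p, Function.Bijective (θ.at p)

/-- `θ` is a branched holomorphic co-parallelism on `TM`. -/
def HolOneForm.IsBranchedCoParallelism (θ : HolOneForm m M V) : Prop :=
  Module.finrank ℂ V = m ∧
    ∃ U : Set M, IsOpen U ∧ Dense U ∧ ∀ p ∈ U, Function.Bijective (θ.at p)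

/-- The wedge product `φ₁ ∧ … ∧ φ_m` of linear forms,
`(v₁, …, v_m) ↦ det (φᵢ (vⱼ))`. -/
def wedge {m : ℕ} {T : Type*} [AddCommGroup T] [Module ℂ T] (φ : Fin m → T →ₗ[ℂ] ℂ) :
    T [⋀^Fin m]→ₗ[ℂ] ℂ :=
  Matrix.detRowAlternating.compLinearMap (LinearMap.pi φ)

/-- The form `ω₁ ∧ … ∧ ω_m`, where `ωᵢ` are the components of the `V`-valued one-form in the
basis `b` of `V`. -/
def HolOneForm.wedgeComponents (θ : HolOneForm m M V) (b : Module.Basis (Fin m) ℂ V) :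
    TopForm m M :=
  fun p => wedge fun i => (b.coord i).comp (θ.at p)

end CoParallelism

/-- `M` is (holomorphically) parallelizable: `TM` has a holomorphic trivialization. -/
def IsParallelizable (m : ℕ) (M : Type*) [TopologicalSpace M]
    [ChartedSpace (EuclideanSpace ℂ (Fin m)) M]
    [IsManifold 𝓘(ℂ, EuclideanSpace ℂ (Fin m)) ω M] : Prop :=
  ∃ θ : HolOneForm m M (EuclideanSpace ℂ (Fin m)), θ.IsParallelism

end

/-! Let `η = ω₁ ∧ … ∧ ω_m`.  In the frame `∂ / ∂ z₁, …, ∂ / ∂ z_m` of the chart at `x` its coefficient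
is `det (ωᵢ (∂ / ∂ zⱼ))`, a holomorphic function on the chart domain which vanishes exactly where
`ω` fails to be an isomorphism (`HolOneForm.coeff_wedgeComponents_ne_zero_iff`).  Since that happens
only off a dense open set, the coefficients are local equations of a divisor `D` whose support is the
branching locus.  On overlaps the coefficients differ by the Jacobian determinants of the coordinate
changes (`TopForm.coeff_eq_jacobian_mul`), which are also the transition functions of `K_M`, so
`𝒪(D) ≅ K_M` (`TopForm.toCocycle_localEquations_iso`).

If `K_M` is trivial and `𝒪(D) ≅ K_M`, then the local equations of `D`, divided by a frame of `𝒪(D)`,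
glue to a global holomorphic function with divisor `D`.  On a compact manifold it is locally
constant by the maximum principle, and it vanishes on no nonempty open set, so it has no zeros and
`D = 0` (`EffectiveDivisor.eq_zero_of_lineBundleClass_eq_trivialClass`).  Finally, if no nonzero
effective divisor represents the canonical class, the divisor of `η` is zero, its support is empty,
and `ω` followed by a linear isomorphism `V ≃ ℂᵐ` is a trivialization of `TM`. -/

/-! ### Coordinate frames and coefficients of top-degree forms -/

section Frames

variable {m : ℕ} {M : Type*} [TopologicalSpace M] [ChartedSpace (EuclideanSpace ℂ (Fin m)) M]
  [IsManifold 𝓘(ℂ, EuclideanSpace ℂ (Fin m)) ω M]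

/-- The frame `∂ / ∂ z₁, …, ∂ / ∂ z_m` of the chart at `x`, as a basis of `T_p M` for `p` in the
domain of that chart. -/
noncomputable def coordBasis (x : M) {p : M}
    (hp : p ∈ (chartAt (EuclideanSpace ℂ (Fin m)) x).source) :
    Module.Basis (Fin m) ℂ (TangentSpace 𝓘(ℂ, EuclideanSpace ℂ (Fin m)) p) :=
  (EuclideanSpace.basisFun (Fin m) ℂ).toBasis.map
    ((trivializationAt (EuclideanSpace ℂ (Fin m))
      (TangentSpace 𝓘(ℂ, EuclideanSpace ℂ (Fin m)) : M → Type _) x).continuousLinearEquivAt ℂ p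
        hp).symm.toLinearEquiv

theorem coordBasis_apply {x p : M} (hp : p ∈ (chartAt (EuclideanSpace ℂ (Fin m)) x).source)
    (i : Fin m) : coordBasis x hp i = coordVector m M x i p := by
  simp only [coordBasis, coordVector, Module.Basis.map_apply, OrthonormalBasis.coe_toBasis,
    EuclideanSpace.basisFun_apply]
  rfl

/-- The change of basis between two coordinate frames has the Jacobian determinant of the change of
coordinates as its determinant. -/
theorem coordBasis_det_coordBasis {x y p : M}
    (hx : p ∈ (chartAt (EuclideanSpace ℂ (Fin m)) x).source)
    (hy : p ∈ (chartAt (EuclideanSpace ℂ (Fin m)) y).source) :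
    (coordBasis y hy).det (coordBasis x hx) = jacobian m M x y p := by
  -- the coordinate change of the tangent bundle is the transition map of its trivializations
  have key : ∀ v, (trivializationAt (EuclideanSpace ℂ (Fin m))
      (TangentSpace 𝓘(ℂ, EuclideanSpace ℂ (Fin m)) : M → Type _) y).continuousLinearEquivAt ℂ p hy
      (((trivializationAt (EuclideanSpace ℂ (Fin m))
      (TangentSpace 𝓘(ℂ, EuclideanSpace ℂ (Fin m)) : M → Type _) x).continuousLinearEquivAt ℂ p
        hx).symm v) = tangentCoordChange 𝓘(ℂ, EuclideanSpace ℂ (Fin m)) x y p v := by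
    intro v
    have h := (tangentBundleCore 𝓘(ℂ, EuclideanSpace ℂ (Fin m)) M).trivializationAt_coordChange_eq
      (b₀ := x) (b₁ := y) (b := p) ⟨hx, hy⟩ v
    rw [Bundle.Trivialization.coordChangeL_apply _ _ ⟨hx, hy⟩] at h
    exact h
  rw [coordBasis, Module.Basis.det_map, jacobian, ContinuousLinearMap.det]
  have hfun : ∀ i, ((trivializationAt (EuclideanSpace ℂ (Fin m))
      (TangentSpace 𝓘(ℂ, EuclideanSpace ℂ (Fin m)) : M → Type _) y).continuousLinearEquivAt ℂ p hy)
      (coordBasis x hx i) = tangentCoordChange 𝓘(ℂ, EuclideanSpace ℂ (Fin m)) x y p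
        ((EuclideanSpace.basisFun (Fin m) ℂ).toBasis i) := fun i => key _
  refine Eq.trans (congrArg (EuclideanSpace.basisFun (Fin m) ℂ).toBasis.det (funext hfun)) ?_
  have h := (EuclideanSpace.basisFun (Fin m) ℂ).toBasis.det_comp
    (tangentCoordChange 𝓘(ℂ, EuclideanSpace ℂ (Fin m)) x y p).toLinearMap
    (EuclideanSpace.basisFun (Fin m) ℂ).toBasis
  rw [Module.Basis.det_self, mul_one] at h
  exact h

/-- `dz₁ʸ ∧ … ∧ dz_mʸ = det (∂ zʸ / ∂ zˣ) dz₁ˣ ∧ … ∧ dz_mˣ`, read on coefficients. -/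
theorem TopForm.coeff_eq_jacobian_mul (η : TopForm m M) {x y p : M}
    (hx : p ∈ (chartAt (EuclideanSpace ℂ (Fin m)) x).source)
    (hy : p ∈ (chartAt (EuclideanSpace ℂ (Fin m)) y).source) :
    η.coeff x p = jacobian m M x y p * η.coeff y p := by
  have ex : η.coeff x p = η p (coordBasis x hx) :=
    congrArg (η p) (funext fun i => (coordBasis_apply hx i).symm)
  have ey : η.coeff y p = η p (coordBasis y hy) :=
    congrArg (η p) (funext fun i => (coordBasis_apply hy i).symm)
  rw [ex, ey, (η p).eq_smul_basis_det (coordBasis y hy), AlternatingMap.smul_apply,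
    AlternatingMap.smul_apply, Module.Basis.det_self, coordBasis_det_coordBasis hx hy, smul_eq_mul,
    smul_eq_mul]
  ring

/-! ### The coefficients of the wedge product of the components of a one-form -/

variable {V : Type*} [NormedAddCommGroup V] [NormedSpace ℂ V]

theorem HolOneForm.wedgeComponents_apply (θ : HolOneForm m M V) (b : Module.Basis (Fin m) ℂ V)
    (p : M) (v : Fin m → TangentSpace 𝓘(ℂ, EuclideanSpace ℂ (Fin m)) p) :
    θ.wedgeComponents b p v = b.det fun j => θ.at p (v j) := by
  rw [Module.Basis.det_apply, ← Matrix.det_transpose]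
  rfl

theorem bijective_iff_basis_det_ne_zero {ι K T W : Type*} [Fintype ι] [DecidableEq ι] [Field K]
    [AddCommGroup T] [Module K T] [AddCommGroup W] [Module K W] (e : Module.Basis ι K T)
    (b : Module.Basis ι K W) (f : T →ₗ[K] W) :
    Function.Bijective f ↔ (b.det fun j => f (e j)) ≠ 0 := by
  rw [← isUnit_iff_ne_zero, ← Module.Basis.is_basis_iff_det]
  constructor
  · intro hf
    let b' := e.map (LinearEquiv.ofBijective f hf)
    have : (fun j => f (e j)) = b' := by ext j; simp [b']
    rw [this]
    exact ⟨b'.linearIndependent, b'.span_eq⟩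
  · rintro ⟨hi, hs⟩
    have : f = (e.equiv (Module.Basis.mk hi hs.ge) (Equiv.refl ι)).toLinearMap :=
      e.ext fun j => by simp
    rw [this]
    exact LinearEquiv.bijective _

theorem HolOneForm.coeff_wedgeComponents_ne_zero_iff (θ : HolOneForm m M V)
    (b : Module.Basis (Fin m) ℂ V) {x p : M}
    (hp : p ∈ (chartAt (EuclideanSpace ℂ (Fin m)) x).source) :
    (θ.wedgeComponents b).coeff x p ≠ 0 ↔ Function.Bijective (θ.at p) := by
  rw [bijective_iff_basis_det_ne_zero (coordBasis x hp) b, TopForm.coeff,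
    HolOneForm.wedgeComponents_apply]
  simp only [coordBasis_apply]

/-- The coordinate components of a holomorphic one-form are holomorphic functions. -/
theorem HolOneForm.hol_apply_coordVector (θ : HolOneForm m M V) (x : M) (j : Fin m) :
    ContMDiffOn 𝓘(ℂ, EuclideanSpace ℂ (Fin m)) 𝓘(ℂ, V) ω
      (fun p => θ.at p (coordVector m M x j p))
      (chartAt (EuclideanSpace ℂ (Fin m)) x).source := by
  have : IsManifold 𝓘(ℂ, EuclideanSpace ℂ (Fin m)) (ω + 1) M := by simpa
  intro p hp
  have h1 := (trivializationAt (EuclideanSpace ℂ (Fin m))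
      (TangentSpace 𝓘(ℂ, EuclideanSpace ℂ (Fin m)) : M → Type _) x).contMDiffAt_symmL
        (n := ω) (IB := 𝓘(ℂ, EuclideanSpace ℂ (Fin m))) (x := p) hp
  have h2 : ContMDiffAt 𝓘(ℂ, EuclideanSpace ℂ (Fin m))
      (𝓘(ℂ, EuclideanSpace ℂ (Fin m)).prod 𝓘(ℂ, EuclideanSpace ℂ (Fin m))) ω
      (fun q : M => Bundle.TotalSpace.mk' (EuclideanSpace ℂ (Fin m))
        (E := Bundle.Trivial M (EuclideanSpace ℂ (Fin m))) q (EuclideanSpace.single j (1 : ℂ))) p :=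
    Bundle.contMDiffAt_totalSpace.2 ⟨contMDiffAt_id, contMDiffAt_const⟩
  have h3 := (θ.contMDiff_toFun p).clm_bundle_apply (h1.clm_bundle_apply h2)
  refine ((Bundle.contMDiffAt_totalSpace.1 h3).2.congr_of_eventuallyEq ?_).contMDiffWithinAt
  filter_upwards [(chartAt (EuclideanSpace ℂ (Fin m)) x).open_source.mem_nhds hp] with q hq
  exact congrArg (θ.at q) (Bundle.Trivialization.symmL_apply _ hq _).symm

theorem HolOneForm.hol_coeff_wedgeComponents [FiniteDimensional ℂ V] (θ : HolOneForm m M V)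
    (b : Module.Basis (Fin m) ℂ V) (x : M) :
    HolOn m ((θ.wedgeComponents b).coeff x) (chartAt (EuclideanSpace ℂ (Fin m)) x).source := by
  have hdet : ContDiff ℂ ω (fun v : Fin m → V => b.det v) := by
    have hc : ∀ i, ContDiff ℂ ω fun w : V => b.repr w i := fun i =>
      (LinearMap.toContinuousLinearMap (b.coord i)).contDiff
    simp only [Module.Basis.det_apply, Matrix.det_apply', Module.Basis.toMatrix_apply]
    refine ContDiff.sum fun σ _ => contDiff_const.mul (contDiff_prod fun i _ => ?_)
    exact (hc _).comp (contDiff_apply ℂ V i)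
  have h : ContMDiffOn 𝓘(ℂ, EuclideanSpace ℂ (Fin m)) 𝓘(ℂ, Fin m → V) ω
      (fun p j => θ.at p (coordVector m M x j p)) (chartAt (EuclideanSpace ℂ (Fin m)) x).source :=
    contMDiffOn_pi_space.2 fun j => θ.hol_apply_coordVector x j
  refine (hdet.contMDiff.comp_contMDiffOn h).congr fun p _ => ?_
  rw [TopForm.coeff, HolOneForm.wedgeComponents_apply]
  rfl

/-- A holomorphic one-form followed by a continuous linear map of its space of values is again a
holomorphic one-form. -/
theorem HolOneForm.exists_postcomp {W : Type*} [NormedAddCommGroup W] [NormedSpace ℂ W]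
    (θ : HolOneForm m M V) (L : V →L[ℂ] W) :
    ∃ θ' : HolOneForm m M W, ∀ p, θ'.at p = L.toLinearMap ∘ₗ θ.at p := by
  refine ⟨⟨fun p => L.comp (θ p), fun p => ?_⟩, fun p => rfl⟩
  have h := θ.contMDiff_toFun p
  rw [contMDiffAt_hom_bundle] at h ⊢
  refine ⟨h.1, ((contMDiffAt_const (c := L)).clm_comp h.2).congr_of_eventuallyEq
    (Filter.Eventually.of_forall fun q => ?_)⟩
  ext v
  simp [ContinuousLinearMap.inCoordinates]
  rfl

end Frames

/-! ### Effective divisors and their line bundles -/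

section Divisors

variable {m : ℕ} {M : Type*} [TopologicalSpace M] [ChartedSpace (EuclideanSpace ℂ (Fin m)) M]

theorem LocalEquations.toCocycle_g_mul (S : LocalEquations m M) {x y p : M}
    (hp : p ∈ S.U x ∩ S.U y) : S.toCocycle.g x y p * S.f y p = S.f x p :=
  ((Classical.choose_spec (S.compat x y)).2 p hp).symm

theorem EffectiveDivisor.support_zero : (0 : EffectiveDivisor m M).support = ∅ :=
  Set.eq_empty_of_forall_notMem fun _ h => one_ne_zero (α := ℂ) h

/-- A divisor whose local equations have no zeros is the zero divisor. -/
theorem LocalEquations.zero_eq_mk {S : LocalEquations m M}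
    (h : ∀ x, ∀ p ∈ S.U x, S.f x p ≠ 0) : (0 : EffectiveDivisor m M) = Quotient.mk _ S :=
  Eq.symm <| Quotient.sound fun x _ => ⟨S.f x, ⟨(S.hol_f x).mono Set.inter_subset_left,
    fun p hp => h x p hp.1⟩, fun _ _ => (mul_one _).symm⟩

theorem LocalEquations.not_eventually_eq_zero (S : LocalEquations m M) (x : M) {p : M}
    (hp : p ∈ S.U x) : ¬ ∀ᶠ q in nhds p, S.f x q = 0 := fun h =>
  (mem_closure_iff_frequently.1 (S.dense_f x hp)) (h.mono fun _ hq => not_not.2 hq)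

/-- On a compact manifold, an effective divisor `D` with trivial line bundle is zero: `D` is the
divisor of a global holomorphic function, which is locally constant. -/
theorem EffectiveDivisor.eq_zero_of_lineBundleClass_eq_trivialClass [CompactSpace M]
    [IsManifold 𝓘(ℂ, EuclideanSpace ℂ (Fin m)) ω M] (D : EffectiveDivisor m M)
    (hD : D.lineBundleClass = trivialClass m M) : D = 0 := by
  obtain ⟨S, rfl⟩ := Quotient.exists_rep D
  obtain ⟨h, hu, hc⟩ : S.toCocycle.Iso _ := Quotient.exact hD
  have hne : ∀ x a, ∀ p ∈ S.U x, h x a p ≠ 0 := fun x a p hp => (hu x a).2 p ⟨hp, trivial⟩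
  -- the quotients `f x / h x x` of the local equations by the local frames agree on overlaps
  have glue : ∀ x y, ∀ p ∈ S.U x ∩ S.U y,
      S.f x p * (h x x p)⁻¹ = S.f y p * (h y y p)⁻¹ := by
    intro x y p hp
    -- the `1` is the transition function of the trivial bundle
    have e : S.toCocycle.g x y p * h y y p = h x x p * 1 :=
      hc x y x y p ⟨hp, trivial, trivial⟩
    rw [← div_eq_mul_inv, ← div_eq_mul_inv, div_eq_div_iff (hne x x p hp.1) (hne y y p hp.2),
      ← S.toCocycle_g_mul hp]
    linear_combination S.f y p * e
  let F : M → ℂ := fun p => S.f p p * (h p p p)⁻¹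
  have hF : ∀ x, ∀ p ∈ S.U x, F p = S.f x p * (h x x p)⁻¹ := fun x p hp =>
    glue p x p ⟨S.mem_U p, hp⟩
  have hol : HolOn m F Set.univ := HolOn.of_locally fun q _ => ⟨S.U q, S.isOpen_U q, S.mem_U q,
    ((((S.hol_f q).mul ((hu q q).mono fun p hp => ⟨hp, trivial⟩).inv.1).congr
      (hF q))).mono Set.inter_subset_right⟩
  have hlc : IsLocallyConstant F := by
    have : IsManifold 𝓘(ℂ, EuclideanSpace ℂ (Fin m)) 1 M := IsManifold.of_le (n := ω) le_top
    exact ((contMDiffOn_univ.1 hol).mdifferentiable (by simp)).isLocallyConstant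
  refine (LocalEquations.zero_eq_mk fun x p hp h0 => ?_).symm
  refine S.not_eventually_eq_zero x hp ?_
  have hFp : F p = 0 := by rw [hF x p hp, h0, zero_mul]
  filter_upwards [hlc.eventually_eq p, (S.isOpen_U x).mem_nhds hp] with q hq hqU
  rw [hFp, hF x q hqU] at hq
  exact (mul_eq_zero.1 hq).resolve_right (inv_ne_zero (hne x x q hqU))

/-! ### The zero divisor of a top-degree form -/

variable [IsManifold 𝓘(ℂ, EuclideanSpace ℂ (Fin m)) ω M]

/-- The local equations of the zero divisor of a section of the canonical bundle whose coefficients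
in the charts are holomorphic and do not vanish identically on any nonempty open set. -/
noncomputable def TopForm.localEquations (η : TopForm m M)
    (hol : ∀ x, HolOn m (η.coeff x) (chartAt (EuclideanSpace ℂ (Fin m)) x).source)
    (dense : ∀ x, (chartAt (EuclideanSpace ℂ (Fin m)) x).source ⊆ closure {p | η.coeff x p ≠ 0}) :
    LocalEquations m M where
  U x := (chartAt (EuclideanSpace ℂ (Fin m)) x).source
  isOpen_U x := (chartAt (EuclideanSpace ℂ (Fin m)) x).open_source
  mem_U x := mem_chart_source _ x
  f := η.coeff
  hol_f := hol
  dense_f := dense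
  compat x y := ⟨jacobian m M x y, (canonicalCocycle m M).unit_g x y,
    fun _ hp => η.coeff_eq_jacobian_mul hp.1 hp.2⟩

/-- The zero divisor of a section of `K_M` represents the canonical class: the quotients of the
coefficients of the section are the transition functions of `K_M`. -/
theorem TopForm.toCocycle_localEquations_iso (η : TopForm m M) (hol) (dense) :
    (η.localEquations hol dense).toCocycle.Iso (canonicalCocycle m M) := by
  set S := η.localEquations hol dense
  have hg : ∀ x y, ∀ p ∈ S.U x ∩ S.U y, S.toCocycle.g x y p = jacobian m M x y p := by
    intro x y
    refine S.cancel y ((S.isOpen_U x).inter (S.isOpen_U y)) Set.inter_subset_right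
      (S.toCocycle.unit_g x y).1.continuousOn (jacobian_hol x y).continuousOn fun p hp => ?_
    rw [S.toCocycle_g_mul hp]
    exact η.coeff_eq_jacobian_mul hp.1 hp.2
  refine ⟨jacobian m M, (canonicalCocycle m M).unit_g, fun x y x' y' p hp => ?_⟩
  rw [hg x y p hp.1, jacobian_comp hp.1.1 hp.1.2 hp.2.2]
  exact (jacobian_comp hp.1.1 hp.2.1 hp.2.2).symm

variable {V : Type*} [NormedAddCommGroup V] [NormedSpace ℂ V]

theorem HolOneForm.IsBranchedCoParallelism.exists_isZeroDivisorOf [FiniteDimensional ℂ V]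
    {θ : HolOneForm m M V} (hθ : θ.IsBranchedCoParallelism) (b : Module.Basis (Fin m) ℂ V) :
    ∃ D : EffectiveDivisor m M, D.IsZeroDivisorOf (θ.wedgeComponents b) ∧
      D.lineBundleClass = canonicalClass m M ∧ D.support = θ.branchingLocus := by
  obtain ⟨-, O, -, hOd, hO⟩ := hθ
  have dense : ∀ x, (chartAt (EuclideanSpace ℂ (Fin m)) x).source ⊆
      closure {p | (θ.wedgeComponents b).coeff x p ≠ 0} := fun x =>
    (hOd.open_subset_closure_inter (chartAt (EuclideanSpace ℂ (Fin m)) x).open_source).trans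
      (closure_mono fun p hp => (θ.coeff_wedgeComponents_ne_zero_iff b hp.1).2 (hO p hp.2))
  let S := (θ.wedgeComponents b).localEquations (θ.hol_coeff_wedgeComponents b) dense
  refine ⟨Quotient.mk _ S, ⟨S, fun _ => rfl, fun _ _ _ => rfl, rfl⟩,
    Quotient.sound (TopForm.toCocycle_localEquations_iso _ _ _), ?_⟩
  ext p
  exact not_iff_not.1 ((θ.coeff_wedgeComponents_ne_zero_iff b (mem_chart_source _ p)).trans
    not_not.symm)

/-- A parallelism with values in any `m`-dimensional space yields one with values in `ℂᵐ`. -/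
theorem HolOneForm.IsParallelism.isParallelizable [FiniteDimensional ℂ V] {θ : HolOneForm m M V}
    (hθ : θ.IsParallelism) : IsParallelizable m M := by
  let L : V ≃L[ℂ] EuclideanSpace ℂ (Fin m) :=
    ContinuousLinearEquiv.ofFinrankEq (by rw [hθ.1, finrank_euclideanSpace_fin])
  obtain ⟨θ', h⟩ := θ.exists_postcomp (L : V →L[ℂ] EuclideanSpace ℂ (Fin m))
  refine ⟨θ', finrank_euclideanSpace_fin, fun p => ?_⟩
  rw [h p]
  exact L.bijective.comp (hθ.2 p)

end Divisors

theorem proposition3p1 (m : ℕ) (M : Type*) [TopologicalSpace M] [T2Space M] [CompactSpace M]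
    [ChartedSpace (EuclideanSpace ℂ (Fin m)) M]
    [IsManifold 𝓘(ℂ, EuclideanSpace ℂ (Fin m)) ω M]
    (V : Type*) [NormedAddCommGroup V] [NormedSpace ℂ V] [FiniteDimensional ℂ V] :
    (∀ θ : HolOneForm m M V, θ.IsBranchedCoParallelism → ∀ b : Module.Basis (Fin m) ℂ V,
      ∃ D : EffectiveDivisor m M, D.IsZeroDivisorOf (θ.wedgeComponents b) ∧
        D.lineBundleClass = canonicalClass m M ∧ D.support = θ.branchingLocus ∧
        (θ.branchingLocus = ∅ ∨ D ≠ 0)) ∧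
    (canonicalClass m M = trivialClass m M → ¬ CanonicalClassHasEffectiveRep m M) ∧
    (¬ CanonicalClassHasEffectiveRep m M →
      ∀ θ : HolOneForm m M V, θ.IsBranchedCoParallelism →
        θ.branchingLocus = ∅ ∧ θ.IsParallelism ∧ IsParallelizable m M) := by
  refine ⟨fun θ hθ b => ?_, ?_, fun hno θ hθ => ?_⟩
  · obtain ⟨D, hD, hcl, hs⟩ := hθ.exists_isZeroDivisorOf b
    refine ⟨D, hD, hcl, hs, or_iff_not_imp_right.2 fun h0 => ?_⟩
    rw [← hs, not_not.1 h0, EffectiveDivisor.support_zero]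
  · rintro htriv ⟨D, hD0, hD⟩
    exact hD0 (D.eq_zero_of_lineBundleClass_eq_trivialClass (hD.trans htriv))
  · obtain ⟨D, -, hcl, hs⟩ := hθ.exists_isZeroDivisorOf
      ((Module.finBasis ℂ V).reindex (finCongr hθ.1))
    have hD0 : D = 0 := not_not.1 fun h0 => hno ⟨D, h0, hcl⟩
    have hempty : θ.branchingLocus = ∅ := by rw [← hs, hD0, EffectiveDivisor.support_zero]
    have hpar : θ.IsParallelism := ⟨hθ.1, fun p => not_not.1 fun hp =>
      Set.notMem_empty p (hempty ▸ hp)⟩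
    exact ⟨hempty, hpar, hpar.isParallelizable⟩
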